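/- Let $(F,d)$ be a non-empty compact metric space and let $s\ge 0$. Suppose that $F$ is $s$-Ahlfors--David regular, that is, there is a constant $C>0$ such that $$ r^s/C \;\le\; \mathcal H^s(B(x,r)) \;\le\; C r^s \qquad\text{for all } x\in F \text{ and all } 0<r<1, $$ where $\mathcal H^s$ is the $s$-dimensional Hausdorff measure and $B(x,r)$ is the closed ball. Let $(P(q))_{q\ge 1}$ be any choice of abstract rationals in $F$: for every integer $q\ge 1$, $P(q)\subseteq F$ is a set whose distinct points are at distance at least $1/q$ from each other and which is maximal with respect to inclusion among such sets. For $t\ge 1$ let $$ F_t=\Big\{x\in F:\ \text{for infinitely many } q \text{ there is } p\in P(q) \text{ with } d(p,x)\le 1/q^t\Big\}. $$ Then for every real $t\ge 1$ $$ \frac st\;\le\;\dim_{\mathrm H}F_t\;\le\;\frac{s+1}{t}. $$ -/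

import Mathlib

/-- A set `A` is `ε`-separated if any two distinct points of `A` are at distance at least `ε`
(a non-strict inequality, unlike in `Metric.IsSeparated`). -/
def IsSepBy {F : Type*} [MetricSpace F] (ε : ℝ) (A : Set F) : Prop :=
  A.Pairwise fun p₁ p₂ => ε ≤ dist p₁ p₂

/-- A choice of abstract rationals: for every level `q ≥ 1` a maximal (with respect to
inclusion) `(1/q)`-separated subset `P q` of `F`. The value `P 0` is irrelevant. -/
def IsAbstractRationals {F : Type*} [MetricSpace F] (P : ℕ → Set F) : Prop :=
  ∀ q : ℕ, 1 ≤ q → Maximal (IsSepBy (1 / (q : ℝ))) (P q)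

/-- The set `F_t` of points `x` such that, for infinitely many `q`, some `p ∈ P q` satisfies
`d(p, x) ≤ 1 / q ^ t`. -/
def wellApprox {F : Type*} [MetricSpace F] (P : ℕ → Set F) (t : ℝ) : Set F :=
  {x | ∃ᶠ q : ℕ in Filter.atTop, ∃ p ∈ P q, dist p x ≤ 1 / (q : ℝ) ^ t}

/-- `F` is `s`-Ahlfors--David regular: the `s`-dimensional Hausdorff measure of every closed
ball of radius `0 < r < 1` is comparable with `r ^ s`, uniformly in the centre and in `r`. -/
def IsADRegular (F : Type*) [MetricSpace F] [MeasurableSpace F] [BorelSpace F] (s : ℝ) : Prop :=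
  ∃ C : ℝ, 0 < C ∧ ∀ (x : F) (r : ℝ), 0 < r → r < 1 →
    ENNReal.ofReal (r ^ s / C) ≤
        MeasureTheory.Measure.hausdorffMeasure s (Metric.closedBall x r) ∧
      MeasureTheory.Measure.hausdorffMeasure s (Metric.closedBall x r) ≤
        ENNReal.ofReal (C * r ^ s)

section

open MeasureTheory Metric Set Filter Topology
open scoped ENNReal NNReal

/-! Upper bound: disjoint balls of radius `1/(3q)` show that `P q` has `O(q^s)` points. The balls of
radius `q^(-t)` around them, over all large `q`, cover `F_t`, and `∑ q^s q^(-dt)` converges once `dt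
> s + 1` (`hausdorffMeasure_wellApprox_ne_top`).

Lower bound: a Cantor set inside `F_t` is built and its dimension read off from its coding. Given
`s' < s`, every ball contains `N ≥ b^s'` well separated balls smaller by the factor `b`
(`IsADRegular.exists_branching`). By maximality of `P q`, a ball of radius `ρ` also contains a ball
of radius `q^(-t)` around a point of `P q`, where `q ≈ 2/ρ`. Passing to it forces approximation but
costs radius, so it is done only when the radii at level `m` stay above `b^(-κm)/2`, for a fixed `κ
> t`; this still happens infinitely often (`frequently_threshold_le`). Codes that first differ at
digit `m` then give points at distance at least a constant times `b^(-κm)`, while `N^(-m) ≤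
b^(-s'm)`. Hence reading codes as base `N` expansions is Hölder of exponent `s'/κ` onto `[0,1]`, and
the dimension is at least `s'/κ`, which can be taken arbitrarily close to `s/t`. -/

/-- Every point of the space is within `1 / q` of some point of the `q`-th level. -/
theorem IsAbstractRationals.exists_dist_le {F : Type*} [MetricSpace F] {P : ℕ → Set F}
    (hP : IsAbstractRationals P) {q : ℕ} (hq : 1 ≤ q) (x : F) :
    ∃ p ∈ P q, dist p x ≤ 1 / (q : ℝ) := by
  by_contra! h
  have hsep : IsSepBy (1 / (q : ℝ)) (insert x (P q)) := by
    refine pairwise_insert.2 ⟨(hP q hq).1, fun b hb _ => ⟨?_, (h b hb).le⟩⟩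
    rw [dist_comm]
    exact (h b hb).le
  have hx : x ∈ P q := (hP q hq).2 hsep (subset_insert _ _) (mem_insert _ _)
  have := h x hx
  rw [dist_self] at this
  exact absurd this (not_lt.2 (by positivity))

/-- A compact Ahlfors--David regular space has finite Hausdorff measure. -/
theorem IsADRegular.hausdorffMeasure_univ_lt_top {F : Type*} [MetricSpace F] [MeasurableSpace F]
    [BorelSpace F] [CompactSpace F] {s : ℝ} (hF : IsADRegular F s) :
    Measure.hausdorffMeasure s (univ : Set F) < ∞ := by
  obtain ⟨C, -, h⟩ := hF
  refine isCompact_univ.measure_lt_top_of_nhdsWithin fun x _ => ?_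
  refine ⟨closedBall x (1 / 2), ?_, ?_⟩
  · exact mem_nhdsWithin_of_mem_nhds (closedBall_mem_nhds x (by norm_num))
  · exact ((h x (1 / 2) (by norm_num) (by norm_num)).2).trans_lt ENNReal.ofReal_lt_top

/-! ### Upper bound: counting rationals and covering by balls. -/

/-- Counting bound for separated sets, with the cardinality written as a sum of ones. -/
theorem IsSepBy.tsum_one_le {F : Type*} [MetricSpace F] [MeasurableSpace F] [BorelSpace F]
    {s C : ℝ} (hC : 0 < C)
    (h : ∀ (x : F) (r : ℝ), 0 < r → r < 1 →
      ENNReal.ofReal (r ^ s / C) ≤ Measure.hausdorffMeasure s (closedBall x r))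
    {A : Set F} {q : ℕ} (hq : 1 ≤ q) (hA : IsSepBy (1 / (q : ℝ)) A) :
    ∑' _ : A, (1 : ℝ≥0∞) ≤
      ENNReal.ofReal (C * 3 ^ s * (q : ℝ) ^ s) * Measure.hausdorffMeasure s (univ : Set F) := by
  have hq0 : (1 : ℝ) ≤ q := by exact_mod_cast hq
  have hr : 1 / (3 * (q : ℝ)) < 1 := by
    rw [div_lt_one (by positivity)]; linarith
  have key : ∑' _ : A, ENNReal.ofReal ((1 / (3 * (q : ℝ))) ^ s / C) ≤
      Measure.hausdorffMeasure s (univ : Set F) := by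
    refine (ENNReal.tsum_le_tsum fun p : A =>
      h (p : F) (1 / (3 * (q : ℝ))) (by positivity) hr).trans ?_
    refine tsum_measure_le_measure_univ (fun p => measurableSet_closedBall.nullMeasurableSet) ?_
    intro p p' hpp'
    -- The factor 3 rather than 2 is needed because the balls are closed and the separation is not
    -- strict: `2/(3q) < 1/q`.
    refine (closedBall_disjoint_closedBall ?_).aedisjoint
    refine lt_of_lt_of_le ?_ (hA p.2 p'.2 (fun e => hpp' (Subtype.ext e)))
    have : (0 : ℝ) < 1 / q := by positivity
    have e : 1 / (3 * (q : ℝ)) = (1 / q) / 3 := by field_simp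
    rw [e]; linarith
  have e : (1 : ℝ≥0∞) = ENNReal.ofReal (C * 3 ^ s * (q : ℝ) ^ s) *
      ENNReal.ofReal ((1 / (3 * (q : ℝ))) ^ s / C) := by
    rw [← ENNReal.ofReal_mul (by positivity), ← ENNReal.ofReal_one]
    congr 1
    rw [one_div, Real.inv_rpow (by positivity), Real.mul_rpow (by positivity) (by positivity)]
    have h3 : (3 : ℝ) ^ s ≠ 0 := (Real.rpow_pos_of_pos (by norm_num) s).ne'
    have h4 : (q : ℝ) ^ s ≠ 0 := (Real.rpow_pos_of_pos (by linarith) s).ne'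
    field_simp
  conv_lhs => rw [e]
  rw [ENNReal.tsum_mul_left]
  gcongr

theorem hausdorffMeasure_wellApprox_ne_top {F : Type*} [MetricSpace F] [MeasurableSpace F]
    [BorelSpace F] [CompactSpace F] {s : ℝ} (hF : IsADRegular F s)
    {P : ℕ → Set F} (hP : IsAbstractRationals P) {t d : ℝ} (ht : 0 < t) (hd : 0 ≤ d)
    (hdt : s + 1 < d * t) :
    Measure.hausdorffMeasure d (wellApprox P t) ≠ ∞ := by
  have hfin := hF.hausdorffMeasure_univ_lt_top
  obtain ⟨C, hC, h⟩ := hF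
  set M := Measure.hausdorffMeasure s (univ : Set F) with hM
  have hcard : ∀ q, 1 ≤ q → ∑' _ : P q, (1 : ℝ≥0∞) ≤
      ENNReal.ofReal (C * 3 ^ s * (q : ℝ) ^ s) * M := fun q hq =>
    IsSepBy.tsum_one_le hC (fun x r hr hr1 => (h x r hr hr1).1) hq (hP q hq).1
  have hcount : ∀ q, 1 ≤ q → Countable (P q) := by
    intro q hq
    have := Summable.countable_support_ennreal (f := fun _ : P q => (1 : ℝ≥0∞))
      ((hcard q hq).trans_lt (ENNReal.mul_lt_top ENNReal.ofReal_lt_top hfin)).ne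
    rw [Function.support_const one_ne_zero, countable_univ_iff] at this
    exact this
  have hcount' : ∀ n k : ℕ, Countable (P (k + (n + 1))) := fun n k => hcount _ (by omega)
  have hdiam : ∀ (x : F) (q : ℕ),
      ediam (closedBall x (1 / (q : ℝ) ^ t)) ≤ ENNReal.ofReal (2 * (1 / (q : ℝ) ^ t)) := by
    intro x q
    refine ediam_le_of_forall_dist_le fun y hy z hz => ?_
    rw [mem_closedBall] at hy hz
    linarith [dist_triangle_right y z x]
  let term : ℕ → ℝ≥0∞ := fun q =>
    ENNReal.ofReal (2 ^ d * (C * 3 ^ s) * (q : ℝ) ^ (-(d * t - s))) * M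
  have hterm : ∀ q, 1 ≤ q →
      ∑' p : P q, ediam (closedBall (p : F) (1 / (q : ℝ) ^ t)) ^ d ≤ term q := by
    intro q hq
    have hq0 : (0 : ℝ) < q := by exact_mod_cast hq
    calc ∑' p : P q, ediam (closedBall (p : F) (1 / (q : ℝ) ^ t)) ^ d
        ≤ ∑' _ : P q, ENNReal.ofReal (2 * (1 / (q : ℝ) ^ t)) ^ d * 1 := by
          refine ENNReal.tsum_le_tsum fun p => ?_
          rw [mul_one]
          exact ENNReal.rpow_le_rpow (hdiam _ _) hd
      _ ≤ ENNReal.ofReal (2 * (1 / (q : ℝ) ^ t)) ^ d *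
            (ENNReal.ofReal (C * 3 ^ s * (q : ℝ) ^ s) * M) := by
          rw [ENNReal.tsum_mul_left]
          gcongr
          exact hcard q hq
      _ = term q := by
          rw [ENNReal.ofReal_rpow_of_nonneg (by positivity) hd, ← mul_assoc,
            ← ENNReal.ofReal_mul (by positivity)]
          simp only [term]
          congr 2
          rw [Real.mul_rpow (by norm_num) (by positivity), one_div, Real.inv_rpow (by positivity),
            ← Real.rpow_mul hq0.le, ← Real.rpow_neg hq0.le,
            show -(d * t - s) = -(t * d) + s by ring, Real.rpow_add hq0]
          ring
  have hsum : ∑' q, term q ≠ ∞ := by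
    simp only [term]
    rw [ENNReal.tsum_mul_right]
    refine ENNReal.mul_ne_top ?_ hfin.ne
    have : Summable fun q : ℕ => 2 ^ d * (C * 3 ^ s) * (q : ℝ) ^ (-(d * t - s)) :=
      (Real.summable_nat_rpow.2 (by linarith)).mul_left _
    exact this.tsum_ofReal_ne_top
  -- The `n`-th cover uses the levels `q ≥ n + 1`; the shift keeps out `q = 0`, where `P` is
  -- arbitrary. Each tail sum is bounded by the whole series, and finiteness is all that is needed.
  have hle := Measure.hausdorffMeasure_le_liminf_tsum (X := F) d (wellApprox P t)
    (l := atTop) (ι := fun n : ℕ => Σ k : ℕ, P (k + (n + 1)))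
    (fun n => ENNReal.ofReal (2 * (1 / ((n : ℕ) : ℝ) ^ t))) ?_
    (fun n i => closedBall (i.2 : F) (1 / ((i.1 + (n + 1) : ℕ) : ℝ) ^ t)) ?_ ?_
  · refine ne_top_of_le_ne_top hsum (hle.trans ?_)
    refine liminf_le_of_le (by isBoundedDefault) fun b hb => ?_
    obtain ⟨n, hn⟩ := hb.exists
    refine hn.trans ?_
    rw [ENNReal.tsum_sigma' ]
    refine (ENNReal.tsum_le_tsum fun k => hterm (k + (n + 1)) (by omega)).trans ?_
    exact ENNReal.tsum_comp_le_tsum_of_injective (add_left_injective (n + 1)) term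
  · have h1 : Tendsto (fun n : ℕ => 2 * (1 / (n : ℝ) ^ t)) atTop (𝓝 0) := by
      have := ((tendsto_rpow_atTop ht).comp tendsto_natCast_atTop_atTop).inv_tendsto_atTop.const_mul
        (2 : ℝ)
      simpa [one_div] using this
    simpa using ENNReal.tendsto_ofReal h1
  · filter_upwards [eventually_ge_atTop 1] with n hn i
    refine (hdiam _ _).trans (ENNReal.ofReal_le_ofReal ?_)
    have : (0 : ℝ) < n := by exact_mod_cast hn
    gcongr
    omega
  · refine Eventually.of_forall fun n x hx => ?_
    obtain ⟨q, hq, p, hp, hpx⟩ := frequently_atTop.1 hx (n + 1)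
    obtain ⟨k, rfl⟩ := Nat.exists_eq_add_of_le' hq
    exact mem_iUnion.2 ⟨⟨k, p, hp⟩, by simpa [dist_comm] using hpx⟩

theorem dimH_wellApprox_le {F : Type*} [MetricSpace F] [MeasurableSpace F] [BorelSpace F]
    [CompactSpace F] {s : ℝ} (hs : 0 ≤ s) (hF : IsADRegular F s)
    {P : ℕ → Set F} (hP : IsAbstractRationals P) {t : ℝ} (ht : 0 < t) :
    dimH (wellApprox P t) ≤ ENNReal.ofReal ((s + 1) / t) := by
  refine le_of_forall_gt_imp_ge_of_dense fun a ha => ?_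
  obtain ⟨d, hd, hda⟩ := ENNReal.lt_iff_exists_nnreal_btwn.1 ha
  refine le_trans (dimH_le_of_hausdorffMeasure_ne_top ?_) hda.le
  refine hausdorffMeasure_wellApprox_ne_top hF hP ht d.2 ?_
  rw [← ENNReal.ofReal_coe_nnreal] at hd
  rw [← div_lt_iff₀ ht]
  exact (ENNReal.ofReal_lt_ofReal_iff_of_nonneg (by positivity)).1 hd

/-! ### Lower bound: dimension from a coding, and branching in regular spaces. -/

/-- A set coded by digit sequences in such a way that sequences which first differ at the `m`-th
digit code points at distance at least a constant times `N ^ (-m / δ)` has dimension at least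
`δ`. -/
theorem le_dimH_range_of_coding {X : Type*} [MetricSpace X] {N : ℕ} (hN : 1 < N)
    (π : (ℕ → Fin N) → X) {δ K : ℝ} (hδ : 0 < δ)
    (hπ : ∀ (ω ω' : ℕ → Fin N) (m : ℕ), (∀ i < m, ω i = ω' i) → ω m ≠ ω' m →
      0 < dist (π ω) (π ω') ∧ ((N : ℝ) ^ m)⁻¹ ≤ K * dist (π ω) (π ω') ^ δ) :
    ENNReal.ofReal δ ≤ dimH (range π) := by
  have hfirst : ∀ ω ω' : ℕ → Fin N, ω ≠ ω' → ∃ m, (∀ i < m, ω i = ω' i) ∧ ω m ≠ ω' m := by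
    intro ω ω' hne
    have hex := Function.ne_iff.1 hne
    classical
    exact ⟨Nat.find hex, fun i hi => not_not.1 (Nat.find_min hex hi), Nat.find_spec hex⟩
  have hinj : Function.Injective π := by
    intro ω ω' h
    by_contra hne
    obtain ⟨m, hm, hm'⟩ := hfirst ω ω' hne
    have := (hπ ω ω' m hm hm').1
    rw [h, dist_self] at this
    exact this.false
  have : Nonempty (ℕ → Fin N) := ⟨fun _ => ⟨0, by omega⟩⟩
  -- The code of a point is read as a base `N` expansion. Agreement of `m` digits puts the values
  -- within `N^(-m)`, so `f` is `δ`-Hölder on the range; it covers `[0,1]`, and a `δ`-Hölder map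
  -- multiplies dimension by at most `1/δ`.
  let f : X → ℝ := fun x => Real.ofDigits (Function.invFun π x)
  have hfπ : ∀ ω, f (π ω) = Real.ofDigits ω := fun ω => by
    simp only [f, Function.leftInverse_invFun hinj ω]
  have hH : HolderOnWith K.toNNReal δ.toNNReal f (range π) := by
    rintro _ ⟨ω, rfl⟩ _ ⟨ω', rfl⟩
    rcases eq_or_ne ω ω' with rfl | hne
    · simp
    obtain ⟨m, hm, hm'⟩ := hfirst ω ω' hne
    have hle := (Real.abs_ofDigits_sub_ofDigits_le hm).trans (hπ ω ω' m hm hm').2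
    rw [hfπ, hfπ, edist_dist, edist_dist, Real.dist_eq, Real.coe_toNNReal _ hδ.le,
      ENNReal.ofReal_rpow_of_nonneg dist_nonneg hδ.le]
    change _ ≤ ENNReal.ofReal K * _
    rw [← ENNReal.ofReal_mul' (by positivity)]
    exact ENNReal.ofReal_le_ofReal hle
  have himage : Icc (0 : ℝ) 1 ⊆ f '' range π := by
    intro y hy
    obtain ⟨ω, -, rfl⟩ := Real.ofDigits_SurjOn hN hy
    exact ⟨π ω, mem_range_self ω, hfπ ω⟩
  have h1 : (1 : ℝ≥0∞) ≤ dimH (range π) / (δ.toNNReal : ℝ≥0∞) := by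
    refine le_trans ?_ (hH.dimH_image_le (Real.toNNReal_pos.2 hδ))
    refine le_trans ?_ (dimH_mono himage)
    rw [Real.dimH_of_nonempty_interior (by simp [interior_Icc])]
    simp
  rw [ENNReal.le_div_iff_mul_le (Or.inl (by simpa using hδ)) (Or.inl (by simp)), one_mul] at h1
  exact h1

/-- In an Ahlfors--David regular space, for every exponent below the dimension, balls contain many
well separated points, at a suitable ratio of scales. -/
theorem IsADRegular.exists_branching {F : Type*} [MetricSpace F] [MeasurableSpace F]
    [BorelSpace F] {s s' : ℝ} (hF : IsADRegular F s) (hs' : 0 < s') (hss : s' < s) :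
    ∃ (b : ℝ) (N : ℕ), 3 < b ∧ b ^ s' ≤ N ∧ ∀ (x : F) (ρ : ℝ), 0 < ρ → ρ < 1 →
      ∃ c : Fin N → F, (∀ i, dist (c i) x ≤ ρ / 2) ∧ ∀ i j, i ≠ j → 3 * (ρ / b) ≤ dist (c i) (c j) := by
  obtain ⟨C, hC, h⟩ := hF
  have hs : 0 < s := hs'.trans hss
  -- choice of the ratio of scales
  obtain ⟨b, hb3, hb⟩ : ∃ b : ℝ, 3 < b ∧ (b ^ s' + 1) * (C * C * 6 ^ s) ≤ b ^ s := by
    have h1 : Tendsto (fun b : ℝ => b ^ (s - s')) atTop atTop :=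
      tendsto_rpow_atTop (sub_pos.2 hss)
    obtain ⟨b, hb3, hb⟩ :=
      ((eventually_gt_atTop (3 : ℝ)).and (h1.eventually_ge_atTop (2 * (C * C * 6 ^ s)))).exists
    refine ⟨b, hb3, ?_⟩
    have hb0 : 0 < b := by linarith
    have h2 : 1 ≤ b ^ s' := Real.one_le_rpow (by linarith) hs'.le
    have h3 : b ^ s = b ^ s' * b ^ (s - s') := by rw [← Real.rpow_add hb0]; ring_nf
    have h4 : 0 < C * C * 6 ^ s := by positivity
    rw [h3]
    nlinarith [mul_le_mul_of_nonneg_left hb (zero_le_one.trans h2)]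
  have hb0 : 0 < b := by linarith
  refine ⟨b, ⌈b ^ s'⌉₊, hb3, Nat.le_ceil _, fun x ρ hρ hρ1 => ?_⟩
  have hη : 0 < 3 * (ρ / b) := by positivity
  have hη1 : 3 * (ρ / b) < 1 := by
    rw [← mul_div_assoc, div_lt_one hb0]; nlinarith
  have hA : ∀ n : ℕ, n ≤ ⌈b ^ s'⌉₊ → ∃ A : Finset F, A.card = n ∧
      (∀ a ∈ A, dist a x ≤ ρ / 2) ∧
        ∀ a ∈ A, ∀ a' ∈ A, a ≠ a' → 3 * (ρ / b) ≤ dist a a' := by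
    intro n
    induction n with
    | zero => exact fun _ => ⟨∅, by simp⟩
    | succ n ih =>
      intro hn
      obtain ⟨A, hcard, hAx, hAsep⟩ := ih (by omega)
      have hnb : (n : ℝ) < b ^ s' := Nat.lt_ceil.1 hn
      -- Greedy choice. If no further point existed, `n < b^s'` balls of radius `3ρ/b` would cover a
      -- ball of radius `ρ/2`; comparing measures gives `b^s ≤ n C² 6^s`, against the choice of `b`.
      obtain ⟨y, hyx, hyA⟩ : ∃ y, dist y x ≤ ρ / 2 ∧ ∀ a ∈ A, 3 * (ρ / b) < dist y a := by
        by_contra! hcon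
        have hcov : closedBall x (ρ / 2) ⊆ ⋃ a ∈ A, closedBall a (3 * (ρ / b)) := by
          intro y hy
          obtain ⟨a, ha, hya⟩ := hcon y hy
          exact mem_biUnion (Finset.mem_coe.2 ha) hya
        have hmeas := ((h x (ρ / 2) (by positivity) (by linarith)).1.trans
          (measure_mono hcov)).trans (measure_biUnion_finset_le A _)
        have hsum := hmeas.trans (Finset.sum_le_sum fun a _ => (h a _ hη hη1).2)
        rw [Finset.sum_const, hcard, nsmul_eq_mul, ← ENNReal.ofReal_natCast,
          ← ENNReal.ofReal_mul (by positivity),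
          ENNReal.ofReal_le_ofReal_iff (by positivity)] at hsum
        have e1 : (3 * (ρ / b)) ^ s = 6 ^ s * (ρ / 2) ^ s / b ^ s := by
          rw [← Real.mul_rpow (by positivity) (by positivity),
            ← Real.div_rpow (by positivity) hb0.le]
          congr 1; ring
        rw [e1, div_le_iff₀ hC] at hsum
        have hρs : 0 < (ρ / 2) ^ s := by positivity
        have hbs : 0 < b ^ s := by positivity
        have e2 : n * (C * (6 ^ s * (ρ / 2) ^ s / b ^ s)) * C =
            (ρ / 2) ^ s * (n * (C * C * 6 ^ s) / b ^ s) := by ring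
        rw [e2, le_mul_iff_one_le_right hρs, one_le_div hbs] at hsum
        have h4 : 0 < C * C * (6 : ℝ) ^ s := by positivity
        nlinarith
      classical
      refine ⟨insert y A, ?_, ?_, ?_⟩
      · rw [Finset.card_insert_of_notMem, hcard]
        intro hy
        have := hyA y hy
        rw [dist_self] at this
        linarith
      · intro a ha
        rcases Finset.mem_insert.1 ha with rfl | ha
        exacts [hyx, hAx a ha]
      · intro a ha a' ha' hne
        rcases Finset.mem_insert.1 ha with h1 | h1 <;> rcases Finset.mem_insert.1 ha' with h2 | h2
        · exact absurd (h1.trans h2.symm) hne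
        · rw [h1]; exact (hyA _ h2).le
        · rw [h2, dist_comm]; exact (hyA _ h1).le
        · exact hAsep a h1 a' h2 hne
  obtain ⟨A, hcard, hAx, hAsep⟩ := hA _ le_rfl
  let e := (A.equivFinOfCardEq hcard).symm
  refine ⟨fun i => e i, fun i => hAx _ (e i).2, fun i j hij => hAsep _ (e i).2 _ (e j).2 ?_⟩
  exact fun h => hij (e.injective (Subtype.ext h))

/-! ### The radii of the Cantor construction. -/

/-- The radius to which a ball of radius `ρ` is shrunk before branching: that of a ball around an
abstract rational with denominator `⌈2 / ρ⌉₊` if this is not below the threshold `τ`, and `ρ`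
otherwise. -/
noncomputable def shrunkRadius (t τ ρ : ℝ) : ℝ :=
  if τ ≤ 1 / (⌈2 / ρ⌉₊ : ℝ) ^ t then 1 / (⌈2 / ρ⌉₊ : ℝ) ^ t else ρ

/-- The radii of the levels of the Cantor set; at each level a ball is shrunk and then divided into
balls smaller by the factor `b`. -/
noncomputable def levelRadius (t κ b : ℝ) : ℕ → ℝ
  | 0 => 1 / 2
  | m + 1 => shrunkRadius t (b * (1 / 2 * b ^ (-(κ * (m + 1 : ℕ))))) (levelRadius t κ b m) / b

/-- The 2 in `⌈2 / ρ⌉₊` splits `ρ` in halves: one for the distance from the centre to a nearby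
rational, the other for the radius of the ball around that rational. -/
theorem one_div_ceil_le {ρ : ℝ} (hρ : 0 < ρ) : 1 / (⌈2 / ρ⌉₊ : ℝ) ≤ ρ / 2 := by
  have h2 : (0 : ℝ) < 2 / ρ := by positivity
  calc 1 / (⌈2 / ρ⌉₊ : ℝ) ≤ 1 / (2 / ρ) := one_div_le_one_div_of_le h2 (Nat.le_ceil _)
    _ = ρ / 2 := by field_simp

theorem one_le_ceil {ρ : ℝ} (hρ : 0 < ρ) : 1 ≤ ⌈2 / ρ⌉₊ := Nat.ceil_pos.2 (by positivity)

theorem one_div_ceil_rpow_le {ρ t : ℝ} (hρ : 0 < ρ) (ht : 1 ≤ t) :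
    1 / (⌈2 / ρ⌉₊ : ℝ) ^ t ≤ ρ / 2 := by
  have h1 : (1 : ℝ) ≤ ⌈2 / ρ⌉₊ := by exact_mod_cast one_le_ceil hρ
  refine le_trans ?_ (one_div_ceil_le hρ)
  exact one_div_le_one_div_of_le (by linarith) (Real.self_le_rpow_of_one_le h1 ht)

theorem shrunkRadius_pos {t τ ρ : ℝ} (hρ : 0 < ρ) : 0 < shrunkRadius t τ ρ := by
  have h1 : (1 : ℝ) ≤ ⌈2 / ρ⌉₊ := by exact_mod_cast one_le_ceil hρ
  unfold shrunkRadius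
  split_ifs
  · positivity
  · exact hρ

theorem shrunkRadius_le {t τ ρ : ℝ} (hρ : 0 < ρ) (ht : 1 ≤ t) : shrunkRadius t τ ρ ≤ ρ := by
  unfold shrunkRadius
  split_ifs
  · linarith [one_div_ceil_rpow_le hρ ht]
  · exact le_rfl

section
variable {t κ b : ℝ}

theorem levelRadius_pos (hb : 0 < b) (m : ℕ) : 0 < levelRadius t κ b m := by
  induction m with
  | zero => norm_num [levelRadius]
  | succ m ih => exact div_pos (shrunkRadius_pos ih) hb

theorem levelRadius_succ_le (hb : 0 < b) (ht : 1 ≤ t) (m : ℕ) :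
    levelRadius t κ b (m + 1) ≤ levelRadius t κ b m / b :=
  div_le_div_of_nonneg_right (shrunkRadius_le (levelRadius_pos hb m) ht) hb.le

theorem levelRadius_le (hb : 1 ≤ b) (ht : 1 ≤ t) (m : ℕ) :
    levelRadius t κ b m ≤ 1 / 2 * (b⁻¹) ^ m := by
  induction m with
  | zero => norm_num [levelRadius]
  | succ m ih =>
    refine (levelRadius_succ_le (by linarith) ht m).trans ?_
    rw [div_eq_mul_inv, pow_succ, ← mul_assoc]
    have : 0 ≤ b⁻¹ := by positivity
    gcongr

/-- The threshold is `b` times the bound wanted at the next level, so a shrunk radius still meets it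
after division by `b`. Without shrinking, the radius loses only the factor `b`, and the bound loses
`b^κ ≥ b`. -/
theorem le_levelRadius (hb : 1 ≤ b) (hκ : 1 ≤ κ) (m : ℕ) :
    1 / 2 * b ^ (-(κ * m)) ≤ levelRadius t κ b m := by
  have hb0 : 0 < b := by linarith
  induction m with
  | zero => simp [levelRadius]
  | succ m ih =>
    rw [levelRadius, le_div_iff₀ hb0, mul_comm, shrunkRadius]
    split_ifs with h
    · exact h
    · refine le_trans ?_ ih
      rw [mul_left_comm]
      gcongr
      calc b * b ^ (-(κ * (m + 1 : ℕ))) = b ^ (1 + -(κ * (m + 1 : ℕ))) := by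
            rw [Real.rpow_add hb0, Real.rpow_one]
        _ ≤ b ^ (-(κ * m)) := by
            refine Real.rpow_le_rpow_of_exponent_le hb ?_
            push_cast
            linarith

/-- Infinitely often the shrinking takes place around abstract rationals. -/
theorem frequently_threshold_le (hb : 1 < b) (ht : 1 ≤ t) (hκ : t < κ) :
    ∃ᶠ m : ℕ in atTop, b * (1 / 2 * b ^ (-(κ * (m + 1 : ℕ)))) ≤
      1 / (⌈2 / levelRadius t κ b m⌉₊ : ℝ) ^ t := by
  have hb0 : 0 < b := by linarith
  intro hcon
  obtain ⟨M, hM⟩ := eventually_atTop.1 hcon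
  -- If shrinking stopped at level `M`, the radii would decay exactly like `b^(-k)` and the
  -- denominators would be `O(b^k)`. The radii around rationals would then be at least of order
  -- `b^(-tk)`, which eventually exceeds the threshold, of order `b^(-κk)`.
  have hrec : ∀ k : ℕ, levelRadius t κ b (M + k) = levelRadius t κ b M * b ^ (-(k : ℝ)) := by
    intro k
    induction k with
    | zero => simp
    | succ k ih =>
      rw [← add_assoc, levelRadius, shrunkRadius, if_neg (hM (M + k) (by omega)), ih]
      push_cast
      rw [neg_add, Real.rpow_add hb0, Real.rpow_neg_one]
      ring
  set ρ := levelRadius t κ b M with hρdef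
  have hρ : 0 < ρ := levelRadius_pos hb0 M
  have hlim : Tendsto (fun k : ℕ => b ^ ((κ - t) * (k : ℝ))) atTop atTop :=
    (tendsto_rpow_atTop_of_base_gt_one b hb).comp
      (tendsto_natCast_atTop_atTop.const_mul_atTop (sub_pos.2 hκ))
  obtain ⟨k, hk⟩ := (hlim.eventually_ge_atTop
    (b * (1 / 2) * b ^ (-(κ * (M + 1 : ℕ))) * (3 / ρ) ^ t)).exists
  refine hM (M + k) (by omega) ?_
  have hceil : (⌈2 / levelRadius t κ b (M + k)⌉₊ : ℝ) ≤ 3 / ρ * b ^ (k : ℝ) := by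
    have hle : levelRadius t κ b (M + k) ≤ 1 := by
      refine (levelRadius_le hb.le ht _).trans ?_
      have : (b⁻¹) ^ (M + k) ≤ 1 := pow_le_one₀ (by positivity) (inv_le_one_of_one_le₀ hb.le)
      linarith
    have hpos := levelRadius_pos (t := t) (κ := κ) hb0 (M + k)
    have h1 : (1 : ℝ) ≤ 1 / levelRadius t κ b (M + k) := by rwa [one_le_div hpos]
    have h2 : 3 / ρ * b ^ (k : ℝ) = 3 / levelRadius t κ b (M + k) := by
      rw [hrec, Real.rpow_neg hb0.le]; field_simp
    rw [h2]
    refine (Nat.ceil_lt_add_one (by positivity)).le.trans ?_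
    calc 2 / levelRadius t κ b (M + k) + 1
        ≤ 2 / levelRadius t κ b (M + k) + 1 / levelRadius t κ b (M + k) := by linarith
      _ = 3 / levelRadius t κ b (M + k) := by rw [← add_div]; norm_num
  have hceil1 : (0 : ℝ) < ⌈2 / levelRadius t κ b (M + k)⌉₊ := by
    exact_mod_cast one_le_ceil (levelRadius_pos hb0 (M + k))
  refine le_trans ?_ (one_div_le_one_div_of_le (by positivity)
    (Real.rpow_le_rpow hceil1.le hceil (by linarith)))
  rw [le_div_iff₀ (by positivity), Real.mul_rpow (by positivity) (by positivity),
    ← Real.rpow_mul hb0.le]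
  have e : b ^ (-(κ * (M + k + 1 : ℕ))) * b ^ ((k : ℝ) * t) * b ^ ((κ - t) * (k : ℝ)) =
      b ^ (-(κ * (M + 1 : ℕ))) := by
    rw [← Real.rpow_add hb0, ← Real.rpow_add hb0]
    congr 1
    push_cast
    ring
  have hX : 0 < b ^ ((κ - t) * (k : ℝ)) := by positivity
  refine le_of_mul_le_mul_right ?_ hX
  calc _ = b * (1 / 2) * (b ^ (-(κ * (M + k + 1 : ℕ))) * b ^ ((k : ℝ) * t) *
          b ^ ((κ - t) * (k : ℝ))) * (3 / ρ) ^ t := by ring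
    _ = b * (1 / 2) * b ^ (-(κ * (M + 1 : ℕ))) * (3 / ρ) ^ t := by rw [e]
    _ ≤ 1 * b ^ ((κ - t) * (k : ℝ)) := by rw [one_mul]; exact hk

end

/-! ### The Cantor set inside `F_t`, and the two bounds combined. -/

/-- Existence of a coding map with values in the set of well approximable points. -/
theorem exists_coding {F : Type*} [MetricSpace F] [CompactSpace F] [Nonempty F]
    {P : ℕ → Set F} (hP : IsAbstractRationals P) {t κ b : ℝ} (ht : 1 ≤ t) (hκ : t < κ) (hb : 3 < b)
    {N : ℕ} (hbranch : ∀ (x : F) (ρ : ℝ), 0 < ρ → ρ < 1 →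
      ∃ c : Fin N → F, (∀ i, dist (c i) x ≤ ρ / 2) ∧
        ∀ i j, i ≠ j → 3 * (ρ / b) ≤ dist (c i) (c j)) :
    ∃ π : (ℕ → Fin N) → F, range π ⊆ wellApprox P t ∧
      ∀ (ω ω' : ℕ → Fin N) (m : ℕ), (∀ i < m, ω i = ω' i) → ω m ≠ ω' m →
        1 / 2 * b ^ (-(κ * (m + 1 : ℕ))) ≤ dist (π ω) (π ω') := by
  have hb0 : 0 < b := by linarith
  have hb1 : 1 < b := by linarith
  set ρ := levelRadius t κ b with hρdef
  have hρpos : ∀ m, 0 < ρ m := levelRadius_pos hb0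
  set τ : ℕ → ℝ := fun m => b * (1 / 2 * b ^ (-(κ * (m + 1 : ℕ)))) with hτ
  set σ : ℕ → ℝ := fun m => shrunkRadius t (τ m) (ρ m) with hσ
  have hρsucc : ∀ m, ρ (m + 1) = σ m / b := fun m => rfl
  have hσpos : ∀ m, 0 < σ m := fun m => shrunkRadius_pos (hρpos m)
  have hσ1 : ∀ m, σ m < 1 := fun m => by
    have h1 : σ m ≤ ρ m := shrunkRadius_le (hρpos m) ht
    have h2 : ρ m ≤ 1 / 2 * (b⁻¹) ^ m := levelRadius_le hb1.le ht m
    have h3 : (b⁻¹) ^ m ≤ 1 := pow_le_one₀ (by positivity) (inv_le_one_of_one_le₀ hb1.le)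
    linarith
  -- the centres after shrinking
  have hmid : ∀ (m : ℕ) (x : F), ∃ y, dist y x + σ m ≤ ρ m ∧
      (τ m ≤ 1 / (⌈2 / ρ m⌉₊ : ℝ) ^ t →
        y ∈ P ⌈2 / ρ m⌉₊ ∧ σ m = 1 / (⌈2 / ρ m⌉₊ : ℝ) ^ t) := by
    intro m x
    by_cases h : τ m ≤ 1 / (⌈2 / ρ m⌉₊ : ℝ) ^ t
    · obtain ⟨y, hy, hyx⟩ := hP.exists_dist_le (one_le_ceil (hρpos m)) x
      have hσm : σ m = 1 / (⌈2 / ρ m⌉₊ : ℝ) ^ t := if_pos h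
      refine ⟨y, ?_, fun _ => ⟨hy, hσm⟩⟩
      rw [hσm]
      linarith [one_div_ceil_rpow_le (hρpos m) ht, one_div_ceil_le (hρpos m)]
    · refine ⟨x, ?_, fun h' => absurd h' h⟩
      rw [dist_self, zero_add]
      exact shrunkRadius_le (hρpos m) ht
  choose mid hmid_le hmid_mem using hmid
  have hchild : ∀ (m : ℕ) (x : F), ∃ c : Fin N → F, (∀ i, dist (c i) x ≤ σ m / 2) ∧
      ∀ i j, i ≠ j → 3 * (σ m / b) ≤ dist (c i) (c j) :=
    fun m x => hbranch x (σ m) (hσpos m) (hσ1 m)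
  choose child hchild_le hchild_sep using hchild
  obtain ⟨x₀⟩ := ‹Nonempty F›
  let c : (ℕ → Fin N) → ℕ → F := fun ω m =>
    Nat.rec x₀ (fun m x => child m (mid m x) (ω m)) m
  have hc : ∀ ω m, c ω (m + 1) = child m (mid m (c ω m)) (ω m) := fun ω m => rfl
  have hsub1 : ∀ ω m, closedBall (c ω (m + 1)) (ρ (m + 1)) ⊆
      closedBall (mid m (c ω m)) (σ m) := by
    intro ω m
    refine closedBall_subset_closedBall' ?_
    rw [hc, hρsucc]
    have h1 := hchild_le m (mid m (c ω m)) (ω m)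
    have h2 : σ m / b ≤ σ m / 2 :=
      div_le_div_of_nonneg_left (hσpos m).le (by norm_num) (by linarith)
    linarith
  have hsub2 : ∀ ω m, closedBall (mid m (c ω m)) (σ m) ⊆ closedBall (c ω m) (ρ m) := by
    intro ω m
    refine closedBall_subset_closedBall' ?_
    linarith [hmid_le m (c ω m)]
  have hπ : ∀ ω, ∃ x, ∀ m, x ∈ closedBall (c ω m) (ρ m) := by
    intro ω
    obtain ⟨x, hx⟩ := IsCompact.nonempty_iInter_of_sequence_nonempty_isCompact_isClosed
      (fun m => closedBall (c ω m) (ρ m)) (fun m => (hsub1 ω m).trans (hsub2 ω m))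
      (fun m => nonempty_closedBall.2 (hρpos m).le) (isClosed_closedBall.isCompact)
      (fun m => isClosed_closedBall)
    exact ⟨x, fun m => mem_iInter.1 hx m⟩
  choose π hπ using hπ
  refine ⟨π, ?_, ?_⟩
  · rintro _ ⟨ω, rfl⟩
    -- Several levels could share a denominator; divergence of the denominators turns infinitely
    -- many shrinking levels into infinitely many `q`.
    have hlim : Tendsto (fun m => ⌈2 / ρ m⌉₊) atTop atTop := by
      have hρ0 : Tendsto ρ atTop (𝓝[>] 0) := by
        refine tendsto_nhdsWithin_iff.2 ⟨?_, Eventually.of_forall hρpos⟩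
        refine squeeze_zero (fun m => (hρpos m).le) (fun m => levelRadius_le hb1.le ht m) ?_
        simpa using (tendsto_pow_atTop_nhds_zero_of_lt_one (by positivity)
          (inv_lt_one_of_one_lt₀ hb1)).const_mul (1 / 2 : ℝ)
      have h1 : Tendsto (fun m => 2 / ρ m) atTop atTop :=
        (tendsto_inv_nhdsGT_zero.comp hρ0).const_mul_atTop two_pos
      exact tendsto_nat_ceil_atTop.comp h1
    refine hlim.frequently ((frequently_threshold_le hb1 ht hκ).mono fun m hm => ?_)
    obtain ⟨hmem, hσm⟩ := hmid_mem m (c ω m) hm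
    refine ⟨mid m (c ω m), hmem, ?_⟩
    rw [dist_comm, ← hσm]
    exact hsub1 ω m (hπ ω (m + 1))
  · intro ω ω' m hm hne
    have hceq : ∀ k ≤ m, c ω k = c ω' k := by
      intro k hk
      induction k with
      | zero => rfl
      | succ k ih => rw [hc, hc, ih (by omega), hm k (by omega)]
    -- The centres are `3 ρ (m + 1)` apart and each point is within `ρ (m + 1)` of its centre, which
    -- leaves a gap of at least `ρ (m + 1)`.
    have hsep := hchild_sep m (mid m (c ω m)) (ω m) (ω' m) hne
    have h1 := hπ ω (m + 1)
    have h2 := hπ ω' (m + 1)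
    rw [mem_closedBall, hc] at h1 h2
    rw [← hceq m le_rfl] at h2
    rw [← hρsucc] at hsep
    have h3 : 1 / 2 * b ^ (-(κ * (m + 1 : ℕ))) ≤ ρ (m + 1) :=
      le_levelRadius hb1.le (ht.trans hκ.le) (m + 1)
    have h4 := dist_triangle4 (child m (mid m (c ω m)) (ω m)) (π ω) (π ω')
      (child m (mid m (c ω m)) (ω' m))
    rw [dist_comm _ (π ω)] at h4
    linarith

/-- For `δ < s/t` there is room for `δt < s' < s`. Then `κ = s'/δ` exceeds `t`, and `b^(-κm)` raised
to the power `δ` is `b^(-s'm)`, the bound for `N^(-m)`. -/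
theorem le_dimH_wellApprox {F : Type*} [MetricSpace F] [MeasurableSpace F] [BorelSpace F]
    [CompactSpace F] [Nonempty F] {s : ℝ} (hF : IsADRegular F s)
    {P : ℕ → Set F} (hP : IsAbstractRationals P) {t : ℝ} (ht : 1 ≤ t) :
    ENNReal.ofReal (s / t) ≤ dimH (wellApprox P t) := by
  have ht0 : 0 < t := by linarith
  refine le_of_forall_lt_imp_le_of_dense fun a ha => ?_
  obtain ⟨δ, had, hδ⟩ := ENNReal.lt_iff_exists_nnreal_btwn.1 ha
  have hδ0 : (0 : ℝ) < δ := NNReal.coe_pos.2 (ENNReal.coe_pos.1 (bot_le.trans_lt had))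
  have hδs : (δ : ℝ) * t < s := by
    rw [← ENNReal.ofReal_coe_nnreal] at hδ
    exact (lt_div_iff₀ ht0).1 ((ENNReal.ofReal_lt_ofReal_iff_of_nonneg δ.2).1 hδ)
  obtain ⟨s', hs1, hs2⟩ := exists_between hδs
  have hs0 : 0 < s' := (mul_pos hδ0 ht0).trans hs1
  obtain ⟨b, N, hb, hN, hbranch⟩ := hF.exists_branching hs0 hs2
  have hb0 : 0 < b := by linarith
  have hκ : t < s' / δ := by rw [lt_div_iff₀ hδ0]; linarith
  obtain ⟨π, hπ, hsep⟩ := exists_coding hP ht hκ hb hbranch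
  have hN1 : 1 < N := by
    have : (1 : ℝ) < N := (Real.one_lt_rpow (by linarith) hs0).trans_le hN
    exact_mod_cast this
  refine had.le.trans (le_trans ?_ (dimH_mono hπ))
  rw [← ENNReal.ofReal_coe_nnreal]
  -- In `K`, the factor `2^δ` absorbs the `1/2` in the separation, and `b^s'` the shift from `m` to
  -- `m + 1`.
  refine le_dimH_range_of_coding hN1 π (K := 2 ^ (δ : ℝ) * b ^ s') hδ0 fun ω ω' m hm hne => ?_
  have hd := hsep ω ω' m hm hne
  have hpos : 0 < 1 / 2 * b ^ (-(s' / δ * (m + 1 : ℕ))) := by positivity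
  refine ⟨hpos.trans_le hd, ?_⟩
  calc ((N : ℝ) ^ m)⁻¹ ≤ ((b ^ s') ^ m)⁻¹ := by gcongr
    _ = 2 ^ (δ : ℝ) * b ^ s' * (1 / 2 * b ^ (-(s' / δ * (m + 1 : ℕ)))) ^ (δ : ℝ) := by
        rw [Real.mul_rpow (by norm_num) (by positivity), ← Real.rpow_mul hb0.le, one_div,
          Real.inv_rpow (by norm_num),
          show -(s' / δ * (m + 1 : ℕ)) * (δ : ℝ) = -(s' * m) + -s' by push_cast; field_simp; ring,
          Real.rpow_add hb0, Real.rpow_neg hb0.le, Real.rpow_neg hb0.le, Real.rpow_mul hb0.le,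
          Real.rpow_natCast]
        have h2 : (2 : ℝ) ^ (δ : ℝ) ≠ 0 := by positivity
        have h3 : b ^ s' ≠ 0 := by positivity
        field_simp
    _ ≤ 2 ^ (δ : ℝ) * b ^ s' * dist (π ω) (π ω') ^ (δ : ℝ) := by gcongr

end

theorem mainTheorem2 {F : Type*} [MetricSpace F] [MeasurableSpace F] [BorelSpace F]
    [CompactSpace F] [Nonempty F] (s : ℝ) (hs : 0 ≤ s) (hF : IsADRegular F s)
    (P : ℕ → Set F) (hP : IsAbstractRationals P) (t : ℝ) (ht : 1 ≤ t) :
    ENNReal.ofReal (s / t) ≤ dimH (wellApprox P t) ∧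
      dimH (wellApprox P t) ≤ ENNReal.ofReal ((s + 1) / t) := by
  exact ⟨le_dimH_wellApprox hF hP ht, dimH_wellApprox_le hs hF hP (zero_lt_one.trans_le ht)⟩
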